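/- Let $(E,\mathcal E)$ be a countably generated measurable space whose diagonal $\Delta=\{(x,x):x\in E\}$ belongs to $\mathcal E\otimes\mathcal E$. Let $X$ be a (discrete-time, time-homogeneous) Markov chain on $E$ with transition probability $P(x,dy)$ (a Markov kernel) and $n$-step transition probabilities $P_n(x,dy)$. An invariant probability measure for $X$ is a probability measure $\mu$ on $(E,\mathcal E)$ such that $\mu(A)=\int_E P(x,A)\,\mu(dx)$ for all $A\in\mathcal E$. Two probability measures $\mu,\nu$ on $(E,\mathcal E)$ are singular if there is $A\in\mathcal E$ with $\mu(A)=1$ and $\nu(A)=0$, and non-singular otherwise; $\|\mu-\nu\|$ denotes the total variation of the signed measure $\mu-\nu$. Assume that for all $x,y\in E$ there exists $n=n_{x,y}$ such that $P_n(x,\cdot)$ and $P_n(y,\cdot)$ are non-singular. Then there exists at most one invariant probability measure for $X$. If an invariant probability measure $\mu$ exists, then for $\mu$-almost all $x\in E$ $$\|P_n(x,\cdot)-\mu\|\to 0,\qquad n\to\infty.$$ -/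

import Mathlib

open MeasureTheory ProbabilityTheory Filter Topology

/-- The total variation distance of two finite measures: the total variation (total mass of the
variation measure) of the signed measure `μ - ν`. It takes values in `[0, 2]` on probability
measures. -/
noncomputable def tvDist {E : Type*} [MeasurableSpace E] (μ ν : Measure E)
    [IsFiniteMeasure μ] [IsFiniteMeasure ν] : ℝ :=
  ((μ.toSignedMeasure - ν.toSignedMeasure).totalVariation Set.univ).toReal

/-- The powers of a Markov kernel under composition are Markov kernels; `P ^ n` is the `n`-step
transition kernel. -/
instance instIsMarkovKernelPow {E : Type*} [MeasurableSpace E] (P : Kernel E E)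
    [IsMarkovKernel P] (n : ℕ) : IsMarkovKernel (P ^ n) := by
  induction n with
  | zero => exact inferInstanceAs (IsMarkovKernel (Kernel.id : Kernel E E))
  | succ n ih => exact inferInstanceAs (IsMarkovKernel ((P ^ n) ∘ₖ P))

open scoped ENNReal

/-! Uniqueness: for distinct invariant `μ`, `ν`, the parts `μ - ν` and `ν - μ` are nonzero,
invariant and mutually singular. Chains started at typical points of the two parts then have
singular laws at every time, contrary to hypothesis (`invariant_unique`).

Convergence: let `D(x, y)` be the limsup of the excess between the laws started at `x` and `y`. It
is subinvariant for two independent copies of the chain, and `μ ⊗ μ` is stationary, so `D` almost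
surely does not increase along the pair (`ae_ae_le_of_le_lintegral`). If the laws at time `n` share
a part of mass `c > 0`, only the remainders contribute, whence `D ≤ (1 - c) D` and `D = 0`
(`limsupExcess_eq_zero`). Averaging over `y` replaces the second law by `μ`. -/

/-- The largest excess `μ A - ν A` over the sets `A` of a countable algebra generating the
σ-algebra. For probability measures it is half of the total variation of `μ - ν`. -/
noncomputable def excess {E : Type*} [MeasurableSpace E] [MeasurableSpace.CountablyGenerated E]
    (μ ν : Measure E) : ℝ≥0∞ :=
  ⨆ A ∈ generateSetAlgebra (MeasurableSpace.countableGeneratingSet E), (μ A - ν A)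

/-! ### Excess as a measurable form of total variation -/

section Excess

variable {E : Type*} [MeasurableSpace E] [MeasurableSpace.CountablyGenerated E]

lemma measurableSet_of_mem_countableAlgebra {A : Set E}
    (hA : A ∈ generateSetAlgebra (MeasurableSpace.countableGeneratingSet E)) :
    MeasurableSet A := by
  have h := MeasurableSpace.measurableSet_generateFrom hA
  rwa [generateFrom_generateSetAlgebra_eq,
    MeasurableSpace.generateFrom_countableGeneratingSet] at h

lemma excess_le_one (μ ν : Measure E) [IsProbabilityMeasure μ] : excess μ ν ≤ 1 :=
  iSup₂_le fun _ _ => tsub_le_self.trans prob_le_one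

lemma excess_self (μ : Measure E) : excess μ μ = 0 := by
  simp [excess]

/-- The algebra is dense among measurable sets for `μ + ν`, so a supremum over it controls all of
them. -/
lemma measure_le_excess_add (μ ν : Measure E) [IsFiniteMeasure μ] [IsFiniteMeasure ν]
    {A : Set E} (hA : MeasurableSet A) : μ A ≤ excess μ ν + ν A := by
  refine ENNReal.le_of_forall_pos_le_add fun ε hε _ => ?_
  have hgen : ‹MeasurableSpace E› = MeasurableSpace.generateFrom
      (generateSetAlgebra (MeasurableSpace.countableGeneratingSet E)) := by
    rw [generateFrom_generateSetAlgebra_eq, MeasurableSpace.generateFrom_countableGeneratingSet]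
  obtain ⟨B, hB, hAB⟩ := (Measure.MeasureDense.of_generateFrom_isSetAlgebra_finite (μ + ν)
    isSetAlgebra_generateSetAlgebra hgen).approx A hA (measure_ne_top _ _) ε (by exact_mod_cast hε)
  rw [ENNReal.ofReal_coe_nnreal, Measure.add_apply] at hAB
  have h1 : μ A ≤ μ B + μ (symmDiff A B) := by
    refine (measure_mono ?_).trans (measure_union_le _ _)
    intro x hx
    by_cases hxB : x ∈ B
    · exact Or.inl hxB
    · exact Or.inr (Or.inl ⟨hx, hxB⟩)
  have h2 : ν B ≤ ν A + ν (symmDiff A B) := by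
    refine (measure_mono ?_).trans (measure_union_le _ _)
    intro x hx
    by_cases hxA : x ∈ A
    · exact Or.inl hxA
    · exact Or.inr (Or.inr ⟨hx, hxA⟩)
  have h3 : μ B ≤ excess μ ν + ν B :=
    tsub_le_iff_right.1 (le_iSup₂_of_le (f := fun A _ => μ A - ν A) B hB le_rfl)
  calc μ A ≤ μ B + μ (symmDiff A B) := h1
    _ ≤ excess μ ν + (ν A + ν (symmDiff A B)) + μ (symmDiff A B) := by
        gcongr; exact h3.trans (by gcongr)
    _ = excess μ ν + ν A + (μ (symmDiff A B) + ν (symmDiff A B)) := by ring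
    _ ≤ excess μ ν + ν A + ε := by gcongr

/-- Countable generation enters here: the supremum runs over countably many sets. -/
lemma measurable_excess {F : Type*} [MeasurableSpace F] (κ η : Kernel F E) :
    Measurable fun z => excess (κ z) (η z) :=
  .biSup _ (countable_generateSetAlgebra
    MeasurableSpace.countable_countableGeneratingSet) fun _ hA =>
    ((κ.measurable_coe (measurableSet_of_mem_countableAlgebra hA)).sub
      (η.measurable_coe (measurableSet_of_mem_countableAlgebra hA)))

lemma measurable_excess_prod (K : Kernel E E) :
    Measurable fun z : E × E => excess (K z.1) (K z.2) :=
  measurable_excess (K.comap Prod.fst measurable_fst) (K.comap Prod.snd measurable_snd)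

/-- Removing a common part `l` from the two initial measures: the excess after a transition is
controlled by the product of the remaining parts. -/
lemma mul_excess_bind_le (K : Kernel E E) [IsMarkovKernel K] {l a b : Measure E}
    [IsFiniteMeasure l] [IsFiniteMeasure a] [IsFiniteMeasure b]
    (hab : a Set.univ = b Set.univ) :
    a Set.univ * excess ((l + a).bind K) ((l + b).bind K) ≤
      ∫⁻ z, excess (K z.1) (K z.2) ∂(a.prod b) := by
  rw [excess, ENNReal.mul_iSup]
  refine iSup_le fun A => ?_
  rw [ENNReal.mul_iSup]
  refine iSup_le fun hA => ?_
  replace hA := measurableSet_of_mem_countableAlgebra hA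
  have hK := K.measurable_coe hA
  rw [Measure.bind_apply hA K.aemeasurable, Measure.bind_apply hA K.aemeasurable,
    lintegral_add_measure, lintegral_add_measure]
  have ha : a Set.univ * ∫⁻ x, K x A ∂a = ∫⁻ z, K z.1 A ∂(a.prod b) := by
    have := lintegral_prod_mul (μ := a) (ν := b) hK.aemeasurable
      (aemeasurable_const (b := (1 : ℝ≥0∞)))
    simpa [hab, mul_comm] using this.symm
  have hb : a Set.univ * ∫⁻ x, K x A ∂b = ∫⁻ z, K z.2 A ∂(a.prod b) := by
    have := lintegral_prod_mul (μ := a) (ν := b) (aemeasurable_const (b := (1 : ℝ≥0∞)))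
      hK.aemeasurable
    simpa using this.symm
  calc a Set.univ * ((∫⁻ x, K x A ∂l + ∫⁻ x, K x A ∂a) - (∫⁻ x, K x A ∂l + ∫⁻ x, K x A ∂b))
      ≤ a Set.univ * (∫⁻ x, K x A ∂a - ∫⁻ x, K x A ∂b) :=
        mul_le_mul' le_rfl add_tsub_add_le_tsub_left
    _ = a Set.univ * ∫⁻ x, K x A ∂a - a Set.univ * ∫⁻ x, K x A ∂b :=
        ENNReal.mul_sub fun _ _ => measure_ne_top _ _
    _ ≤ ∫⁻ z, excess (K z.1) (K z.2) ∂(a.prod b) := by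
        rw [tsub_le_iff_right, ha, hb, ← lintegral_add_left (measurable_excess_prod K)]
        exact lintegral_mono fun z => measure_le_excess_add _ _ hA

lemma excess_le_lintegral_excess {F : Type*} [MeasurableSpace F] (κ : Kernel F E)
    [IsMarkovKernel κ] (ν : Measure E) [IsFiniteMeasure ν] (μ : Measure F)
    [IsProbabilityMeasure μ] :
    excess ν (κ ∘ₘ μ) ≤ ∫⁻ y, excess ν (κ y) ∂μ := by
  refine iSup₂_le fun A hA => ?_
  replace hA := measurableSet_of_mem_countableAlgebra hA
  rw [Measure.bind_apply hA κ.aemeasurable, tsub_le_iff_right,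
    ← lintegral_add_right _ (κ.measurable_coe hA)]
  calc ν A = ∫⁻ _, ν A ∂μ := by simp
    _ ≤ _ := lintegral_mono fun y => measure_le_excess_add _ _ hA

lemma tvDist_le_two_mul_excess (μ ν : Measure E) [IsProbabilityMeasure μ]
    [IsProbabilityMeasure ν] : tvDist μ ν ≤ 2 * (excess μ ν).toReal := by
  have hfin : excess μ ν ≠ ∞ := ((excess_le_one μ ν).trans_lt ENNReal.one_lt_top).ne
  have key : ∀ A, MeasurableSet A → μ.real A - ν.real A ≤ (excess μ ν).toReal := by
    intro A hA
    have h := ENNReal.toReal_mono (by finiteness) (measure_le_excess_add μ ν hA)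
    rw [ENNReal.toReal_add hfin (measure_ne_top _ _)] at h
    exact sub_le_iff_le_add.2 h
  obtain ⟨i, hi, hi₂, hi₃, hpos, hneg⟩ :=
    (μ.toSignedMeasure - ν.toSignedMeasure).toJordanDecomposition_spec
  rw [tvDist, SignedMeasure.totalVariation, Measure.add_apply, hpos, hneg,
    ENNReal.toReal_add (measure_ne_top _ _) (measure_ne_top _ _), ← measureReal_def,
    ← measureReal_def, SignedMeasure.toMeasureOfZeroLE_real_apply _ hi₂ hi .univ,
    SignedMeasure.toMeasureOfLEZero_real_apply _ hi₃ hi.compl .univ]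
  simp only [Set.inter_univ, sub_apply, Measure.toSignedMeasure_apply_measurable hi,
    Measure.toSignedMeasure_apply_measurable hi.compl]
  have h1 := key i hi
  have h2 := probReal_compl_eq_one_sub (μ := μ) hi
  have h3 := probReal_compl_eq_one_sub (μ := ν) hi
  linarith

end Excess

/-! ### Invariant measures and uniqueness -/

section Invariant

variable {E : Type*} [MeasurableSpace E]

lemma invariant_pow {P : Kernel E E} {μ : Measure E} (h : Kernel.Invariant P μ) (n : ℕ) :
    Kernel.Invariant (P ^ n) μ := by
  induction n with
  | zero => exact Measure.id_comp
  | succ n ih => exact ih.comp h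

lemma invariant_parallelComp {κ η : Kernel E E} [IsMarkovKernel κ] [IsMarkovKernel η]
    {μ ν : Measure E} [IsProbabilityMeasure μ] [IsProbabilityMeasure ν]
    (hμ : Kernel.Invariant κ μ) (hν : Kernel.Invariant η ν) :
    Kernel.Invariant (κ ∥ₖ η) (μ.prod ν) := by
  have h := Measure.prod_comp_left (μ := μ) (ν := η ∘ₘ ν) (κ := κ)
  rw [Measure.prod_comp_right (μ := μ), Measure.comp_assoc, Kernel.parallelComp_comp_parallelComp,
    Kernel.comp_id, Kernel.id_comp, hμ.def, hν.def] at h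
  exact h.symm

/-- A subinvariant function decreases along almost every path of a stationary chain. -/
lemma ae_ae_le_of_le_lintegral {Q : Kernel E E} [IsMarkovKernel Q] {π : Measure E}
    [IsProbabilityMeasure π] (hπ : Kernel.Invariant Q π) {D : E → ℝ≥0∞} (hD : Measurable D)
    (hD1 : ∀ z, D z ≤ 1) (hsub : ∀ z, D z ≤ ∫⁻ w, D w ∂(Q z)) :
    ∀ᵐ z ∂π, ∀ᵐ w ∂(Q z), D w ≤ D z := by
  -- The truncation `(D - q)⁺` is again subinvariant, and stationarity equates its integrals before
  -- and after a step, forcing equality a.e. Where `D z ≤ q` both sides vanish.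
  have key : ∀ q : ℚ, ∀ᵐ z ∂π,
      D z - ENNReal.ofReal q = ∫⁻ w, (D w - ENNReal.ofReal q) ∂(Q z) := by
    intro q
    set t := ENNReal.ofReal q
    have hm : Measurable fun z => D z - t := hD.sub measurable_const
    refine ae_eq_of_ae_le_of_lintegral_le (ae_of_all _ fun z => ?_) ?_
      hm.lintegral_kernel.aemeasurable ?_
    · refine tsub_le_iff_right.2 ((hsub z).trans ?_)
      calc ∫⁻ w, D w ∂(Q z) ≤ ∫⁻ w, (D w - t + t) ∂(Q z) := lintegral_mono fun w => le_tsub_add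
        _ = ∫⁻ w, (D w - t) ∂(Q z) + t := by
          rw [lintegral_add_right _ measurable_const]; simp
    · refine ne_top_of_le_ne_top ENNReal.one_ne_top ?_
      calc ∫⁻ z, (D z - t) ∂π ≤ ∫⁻ _, 1 ∂π :=
            lintegral_mono fun z => tsub_le_self.trans (hD1 z)
        _ = 1 := by simp
    · rw [← Measure.lintegral_bind Q.aemeasurable hm.aemeasurable, hπ.def]
  filter_upwards [ae_all_iff.2 key] with z hz
  have h : ∀ q : ℚ, ∀ᵐ w ∂(Q z), D z ≤ ENNReal.ofReal q → D w ≤ ENNReal.ofReal q := by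
    intro q
    by_cases hq : D z ≤ ENNReal.ofReal q
    · have h0 := hz q
      rw [tsub_eq_zero_of_le hq, eq_comm, lintegral_eq_zero_iff (by fun_prop)] at h0
      filter_upwards [h0] with w hw _
      exact tsub_eq_zero_iff_le.1 hw
    · exact ae_of_all _ fun _ h => absurd h hq
  filter_upwards [ae_all_iff.2 h] with w hw
  refine le_of_forall_gt fun c hc => ?_
  obtain ⟨q, _, hzq, hqc⟩ := ENNReal.lt_iff_exists_rat_btwn.1 hc
  exact (hw q hzq.le).trans_lt hqc

lemma measureReal_sub_measureReal (μ ν : Measure E) [IsFiniteMeasure μ] [IsFiniteMeasure ν]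
    {A : Set E} (hA : MeasurableSet A) :
    μ.real A - ν.real A = (μ - ν).real A - (ν - μ).real A := by
  have h := congrArg (fun s => s A)
    (Measure.sub_toSignedMeasure_eq_toSignedMeasure_sub (μ := μ) (ν := ν))
  simpa [Measure.toSignedMeasure_apply_measurable hA] using h

lemma measure_le_sub_add (μ ν : Measure E) [IsFiniteMeasure μ] [IsFiniteMeasure ν] :
    μ ≤ (μ - ν) + ν := by
  refine Measure.le_iff.2 fun A hA => ?_
  have h := measureReal_sub_measureReal μ ν hA
  have h0 : 0 ≤ (ν - μ).real A := measureReal_nonneg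
  rw [← ENNReal.toReal_le_toReal (measure_ne_top _ _) (measure_ne_top _ _), Measure.add_apply,
    ENNReal.toReal_add (measure_ne_top _ _) (measure_ne_top _ _)]
  simp only [← measureReal_def]
  linarith

lemma measure_sub_ne_zero {μ ν : Measure E} [IsProbabilityMeasure μ] [IsProbabilityMeasure ν]
    (h : μ ≠ ν) : μ - ν ≠ 0 := by
  intro h0
  have hle := measure_le_sub_add μ ν
  rw [h0, zero_add] at hle
  exact h (Measure.eq_of_le_of_measure_univ_eq hle (by simp))

/-- Applying `P` to `μ ≤ (μ - ν) + ν` gives `μ - ν ≤ P(μ - ν)` by minimality of the difference; the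
two total masses agree. -/
lemma invariant_sub {P : Kernel E E} [IsMarkovKernel P] {μ ν : Measure E} [IsFiniteMeasure μ]
    [IsFiniteMeasure ν] (hμ : Kernel.Invariant P μ) (hν : Kernel.Invariant P ν) :
    Kernel.Invariant P (μ - ν) := by
  refine (Measure.eq_of_le_of_measure_univ_eq (Measure.sub_le_of_le_add ?_) ?_).symm
  · refine Measure.le_iff.2 fun A hA => ?_
    calc μ A = ∫⁻ x, P x A ∂μ := by rw [← Measure.bind_apply hA P.aemeasurable, hμ.def]
      _ ≤ ∫⁻ x, P x A ∂((μ - ν) + ν) := lintegral_mono' (measure_le_sub_add μ ν) le_rfl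
      _ = (P ∘ₘ (μ - ν) + ν) A := by
        rw [lintegral_add_measure, ← Measure.bind_apply hA P.aemeasurable,
          ← Measure.bind_apply hA P.aemeasurable, hν.def, Measure.add_apply]
  · rw [Measure.bind_apply .univ P.aemeasurable]; simp

/-- If the transition probabilities from any two points are eventually non-singular, there is at
most one invariant probability measure. -/
lemma invariant_unique {P : Kernel E E} [IsMarkovKernel P]
    (hP : ∀ x y : E, ∃ n : ℕ, ¬ ((P ^ n) x ⟂ₘ (P ^ n) y)) {μ ν : Measure E}
    [IsProbabilityMeasure μ] [IsProbabilityMeasure ν]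
    (hμ : Kernel.Invariant P μ) (hν : Kernel.Invariant P ν) : μ = ν := by
  by_contra hne
  have := ae_neBot.2 (measure_sub_ne_zero hne)
  have := ae_neBot.2 (measure_sub_ne_zero (Ne.symm hne))
  have null : ∀ {σ : Measure E}, Kernel.Invariant P σ → ∀ {A : Set E}, MeasurableSet A →
      σ A = 0 → ∀ᵐ x ∂σ, ∀ n : ℕ, (P ^ n) x A = 0 := by
    intro σ hσ A hA h0
    refine ae_all_iff.2 fun n => ?_
    rw [← (invariant_pow hσ n).def, Measure.bind_apply hA (P ^ n).aemeasurable,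
      lintegral_eq_zero_iff ((P ^ n).measurable_coe hA)] at h0
    exact h0
  obtain ⟨s, hs, hs1, hs2⟩ := Measure.mutually_singular_measure_sub (μ := μ) (ν := ν)
  obtain ⟨x, hx⟩ := (null (invariant_sub hμ hν) hs hs1).exists
  obtain ⟨y, hy⟩ := (null (invariant_sub hν hμ) hs.compl hs2).exists
  obtain ⟨n, hn⟩ := hP x y
  exact hn ⟨s, hs, hx n, hy n⟩

lemma exists_common_part {μ ν : Measure E} (h : ¬ μ ⟂ₘ ν) :
    ∃ l : Measure E, l ≤ μ ∧ l ≤ ν ∧ l ≠ 0 := by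
  rw [Measure.mutuallySingular_iff_disjoint, disjoint_iff_inf_le] at h
  exact ⟨μ ⊓ ν, inf_le_left, inf_le_right, fun h0 => h (h0 ▸ bot_le)⟩

end Invariant

/-! ### Vanishing of the asymptotic excess -/

section Convergence

variable {E : Type*} [MeasurableSpace E] [MeasurableSpace.CountablyGenerated E]

/-- The asymptotic excess of the laws of the chain started from a pair of points. -/
noncomputable def limsupExcess (P : Kernel E E) (z : E × E) : ℝ≥0∞ :=
  limsup (fun m : ℕ => excess ((P ^ m) z.1) ((P ^ m) z.2)) atTop

lemma measurable_limsupExcess (P : Kernel E E) : Measurable (limsupExcess P) :=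
  .limsup fun m => measurable_excess_prod (P ^ m)

lemma limsupExcess_le_one (P : Kernel E E) [IsMarkovKernel P] (z : E × E) :
    limsupExcess P z ≤ 1 :=
  limsup_le_of_le (h := Eventually.of_forall fun _ => excess_le_one _ _)

lemma limsup_lintegral_excess_le (P : Kernel E E) [IsMarkovKernel P] (π : Measure (E × E))
    [IsFiniteMeasure π] :
    limsup (fun m : ℕ => ∫⁻ z, excess ((P ^ m) z.1) ((P ^ m) z.2) ∂π) atTop ≤
      ∫⁻ z, limsupExcess P z ∂π :=
  limsup_lintegral_le (fun _ => 1) (fun m => measurable_excess_prod (P ^ m))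
    (fun _ => ae_of_all _ fun _ => excess_le_one _ _) (by simp)

lemma mul_limsupExcess_le (P : Kernel E E) [IsMarkovKernel P] {l a b : Measure E}
    [IsFiniteMeasure l] [IsFiniteMeasure a] [IsFiniteMeasure b]
    (hab : a Set.univ = b Set.univ) {n : ℕ} {z : E × E}
    (h₁ : l + a = (P ^ n) z.1) (h₂ : l + b = (P ^ n) z.2) :
    a Set.univ * limsupExcess P z ≤ ∫⁻ w, limsupExcess P w ∂(a.prod b) := by
  refine le_trans ?_ (limsup_lintegral_excess_le P (a.prod b))
  rw [limsupExcess, ← limsup_nat_add _ n, ← ENNReal.limsup_const_mul_of_ne_top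
    (measure_ne_top _ _)]
  refine limsup_le_limsup (Eventually.of_forall fun m => ?_)
  have h := mul_excess_bind_le (P ^ m) (l := l) hab
  rw [h₁, h₂] at h
  simpa only [Kernel.pow_add, Kernel.comp_apply] using h

lemma limsupExcess_le_lintegral (P : Kernel E E) [IsMarkovKernel P] (n : ℕ) (z : E × E) :
    limsupExcess P z ≤ ∫⁻ w, limsupExcess P w ∂(((P ^ n) ∥ₖ (P ^ n)) z) := by
  have h := mul_limsupExcess_le P (l := 0) (a := (P ^ n) z.1) (b := (P ^ n) z.2) (z := z)
    (by simp) (zero_add _) (zero_add _)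
  rw [Kernel.parallelComp_apply]
  simpa using h

lemma limsupExcess_eq_zero {P : Kernel E E} [IsMarkovKernel P] {n : ℕ} {z : E × E}
    (hns : ¬ ((P ^ n) z.1 ⟂ₘ (P ^ n) z.2))
    (hae : ∀ᵐ w ∂(((P ^ n) ∥ₖ (P ^ n)) z), limsupExcess P w ≤ limsupExcess P z) :
    limsupExcess P z = 0 := by
  obtain ⟨l, hl₁, hl₂, hl₀⟩ := exists_common_part hns
  have : IsFiniteMeasure l := isFiniteMeasure_of_le _ hl₁
  set a := (P ^ n) z.1 - l
  set b := (P ^ n) z.2 - l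
  have ha : l + a = (P ^ n) z.1 := by rw [add_comm]; exact Measure.sub_add_cancel_of_le hl₁
  have hb : l + b = (P ^ n) z.2 := by rw [add_comm]; exact Measure.sub_add_cancel_of_le hl₂
  have ha1 : l Set.univ + a Set.univ = 1 := by
    rw [← Measure.add_apply, ha, measure_univ]
  have hb1 : l Set.univ + b Set.univ = 1 := by
    rw [← Measure.add_apply, hb, measure_univ]
  have hab : a Set.univ = b Set.univ :=
    (ENNReal.add_right_inj (measure_ne_top l _)).1 (ha1.trans hb1.symm)
  -- The a.e. bound under independent copies passes to the product of the remainders.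
  have hac : a.prod b ≪ ((P ^ n) ∥ₖ (P ^ n)) z := by
    rw [Kernel.parallelComp_apply]
    exact (Measure.absolutelyContinuous_of_le Measure.sub_le).prod
      (Measure.absolutelyContinuous_of_le Measure.sub_le)
  have h : a Set.univ * limsupExcess P z ≤
      a Set.univ * (a Set.univ * limsupExcess P z) := by
    calc a Set.univ * limsupExcess P z ≤ ∫⁻ w, limsupExcess P w ∂(a.prod b) :=
          mul_limsupExcess_le P hab ha hb
      _ ≤ ∫⁻ _, limsupExcess P z ∂(a.prod b) := lintegral_mono_ae (hac.ae_le hae)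
      _ = a Set.univ * (a Set.univ * limsupExcess P z) := by
        rw [lintegral_const, ← Set.univ_prod_univ, Measure.prod_prod, ← hab]; ring
  -- If nothing remains, the laws agree from time `n` on and the factor cannot be cancelled.
  by_cases ha0 : a Set.univ = 0
  · have hb0 : b = 0 := Measure.measure_univ_eq_zero.1 (hab ▸ ha0)
    have hPz : (P ^ n) z.1 = (P ^ n) z.2 := by
      rw [← ha, ← hb, hb0, Measure.measure_univ_eq_zero.1 ha0]
    rw [limsupExcess, ← limsup_nat_add _ n]
    simp [Kernel.pow_add, Kernel.comp_apply, hPz, excess_self]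
  · have h' : limsupExcess P z ≤ a Set.univ * limsupExcess P z :=
      (ENNReal.mul_le_mul_iff_right ha0 (measure_ne_top _ _)).1 h
    by_contra hD0
    have hDtop : limsupExcess P z ≠ ∞ :=
      ((limsupExcess_le_one P z).trans_lt ENNReal.one_lt_top).ne
    have h1 : 1 ≤ a Set.univ := by
      rw [← ENNReal.mul_le_mul_iff_left hD0 hDtop, one_mul]; exact h'
    have hl : l Set.univ ≠ 0 := fun h0 => hl₀ (Measure.measure_univ_eq_zero.1 h0)
    have : a Set.univ < l Set.univ + a Set.univ := by
      rw [add_comm]; exact ENNReal.lt_add_right (measure_ne_top _ _) hl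
    exact absurd (ha1 ▸ this) h1.not_gt

lemma ae_limsupExcess_eq_zero {P : Kernel E E} [IsMarkovKernel P]
    (hP : ∀ x y : E, ∃ n : ℕ, ¬ ((P ^ n) x ⟂ₘ (P ^ n) y)) {μ : Measure E}
    [IsProbabilityMeasure μ] (hμ : Kernel.Invariant P μ) :
    ∀ᵐ z ∂(μ.prod μ), limsupExcess P z = 0 := by
  have h : ∀ n : ℕ, ∀ᵐ z ∂(μ.prod μ), ∀ᵐ w ∂(((P ^ n) ∥ₖ (P ^ n)) z),
      limsupExcess P w ≤ limsupExcess P z := fun n =>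
    ae_ae_le_of_le_lintegral (invariant_parallelComp (invariant_pow hμ n) (invariant_pow hμ n))
      (measurable_limsupExcess P) (limsupExcess_le_one P) (limsupExcess_le_lintegral P n)
  filter_upwards [ae_all_iff.2 h] with z hz
  obtain ⟨n, hn⟩ := hP z.1 z.2
  exact limsupExcess_eq_zero hn (hz n)

lemma ae_tendsto_excess {P : Kernel E E} [IsMarkovKernel P]
    (hP : ∀ x y : E, ∃ n : ℕ, ¬ ((P ^ n) x ⟂ₘ (P ^ n) y)) {μ : Measure E}
    [IsProbabilityMeasure μ] (hμ : Kernel.Invariant P μ) :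
    ∀ᵐ x ∂μ, Tendsto (fun n : ℕ => excess ((P ^ n) x) μ) atTop (𝓝 0) := by
  filter_upwards [Measure.ae_ae_of_ae_prod (ae_limsupExcess_eq_zero hP hμ)] with x hx
  -- Reverse Fatou, with dominating function 1.
  have hint : limsup (fun n : ℕ => ∫⁻ y, excess ((P ^ n) x) ((P ^ n) y) ∂μ) atTop = 0 := by
    refine le_antisymm ?_ zero_le
    refine (limsup_lintegral_le (fun _ => 1)
      (fun n => (measurable_excess_prod (P ^ n)).comp measurable_prodMk_left)
      (fun _ => ae_of_all _ fun _ => excess_le_one _ _) (by simp)).trans ?_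
    exact ((lintegral_congr_ae hx).trans lintegral_zero).le
  have hlim : Tendsto (fun n : ℕ => ∫⁻ y, excess ((P ^ n) x) ((P ^ n) y) ∂μ) atTop (𝓝 0) :=
    tendsto_of_le_liminf_of_limsup_le zero_le hint.le
  refine tendsto_of_tendsto_of_tendsto_of_le_of_le tendsto_const_nhds hlim
    (fun _ => zero_le) fun n => ?_
  have h := excess_le_lintegral_excess (P ^ n) ((P ^ n) x) μ
  rwa [(invariant_pow hμ n).def] at h

end Convergence

theorem corollary1 {E : Type*} [MeasurableSpace E] [MeasurableSpace.CountablyGenerated E]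
    (hdiag : MeasurableSet (Set.diagonal E))
    (P : Kernel E E) [IsMarkovKernel P]
    (hP : ∀ x y : E, ∃ n : ℕ, ¬ ((P ^ n) x ⟂ₘ (P ^ n) y)) :
    (∀ μ₁ μ₂ : Measure E, IsProbabilityMeasure μ₁ → IsProbabilityMeasure μ₂ →
      Kernel.Invariant P μ₁ → Kernel.Invariant P μ₂ → μ₁ = μ₂) ∧
    (∀ (μ : Measure E) [IsProbabilityMeasure μ], Kernel.Invariant P μ →
      ∀ᵐ x ∂μ, Tendsto (fun n : ℕ => tvDist ((P ^ n) x) μ) atTop (𝓝 0)) := by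
  refine ⟨fun μ₁ μ₂ _ _ h₁ h₂ => invariant_unique hP h₁ h₂, fun μ _ hμ => ?_⟩
  filter_upwards [ae_tendsto_excess hP hμ] with x hx
  have h : Tendsto (fun n : ℕ => 2 * (excess ((P ^ n) x) μ).toReal) atTop (𝓝 0) := by
    simpa using ((ENNReal.tendsto_toReal ENNReal.zero_ne_top).comp hx).const_mul 2
  exact squeeze_zero (fun _ => ENNReal.toReal_nonneg) (fun _ => tvDist_le_two_mul_excess _ _) h
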